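/- Let $f_0=f_1=1$ and $f_n=f_{n-1}+f_{n-2}$ for $n\ge 2$ be the Fibonacci numbers, let $\omega$ be the space of all real sequences $x=(x_k)_{k\ge 0}$, and let $p=(p_k)_{k\ge 0}$ be a bounded sequence of strictly positive real numbers. Let $$\ell_\infty(\widehat F,p)=\Big\{x\in\omega:\ \sup_{n\ge 0}\Big|\frac{f_n}{f_{n+1}}x_n-\frac{f_{n+1}}{f_n}x_{n-1}\Big|^{p_n}<\infty\Big\},\qquad x_{-1}:=0.$$ For $X\subseteq\omega$, let $X^\alpha$, $X^\beta$, $X^\gamma$ be the sets of all $a\in\omega$ such that, for every $x\in X$, the series $\sum_k a_kx_k$ converges absolutely, converges, or has bounded partial sums, respectively. Let $\mathcal F$ be the collection of all finite subsets of $\mathbb N=\{0,1,2,\dots\}$. For $a\in\omega$ and $0\le k\le n$ put $$c_{nk}(a)=\frac{f_{n+1}^2}{f_kf_{k+1}}\,a_n,\qquad d_{nk}(a)=\sum_{j=k}^{n}\frac{f_{j+1}^2}{f_kf_{k+1}}\,a_j .$$ With $B$ ranging over the integers greater than $1$, define $$\widehat F_8(p)=\bigcap_{B>1}\Big\{a\in\omega:\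 \sup_{K\in\mathcal F}\sum_{n=0}^\infty\Big|\sum_{k\in K,\ k\le n}c_{nk}(a)B^{1/p_k}\Big|<\infty\Big\},$$ $$\widehat F_9(p)=\widehat F_{11}(p)=\bigcap_{B>1}\Big\{a\in\omega:\ \sup_{n\ge 0}\sum_{k=0}^{n}|d_{nk}(a)|B^{1/p_k}<\infty\Big\},$$ $$\widehat F_{10}(p)=\bigcap_{B>1}\Big\{a\in\omega:\ \exists(\alpha_k)\in\omega,\ \lim_{n\to\infty}\sum_{k=0}^{n}|d_{nk}(a)-\alpha_k|B^{1/p_k}=0\Big\}.$$ Then (i) $\{\ell_\infty(\widehat F,p)\}^\alpha=\widehat F_8(p)$; (ii) $\{\ell_\infty(\widehat F,p)\}^\beta=\widehat F_9(p)\cap\widehat F_{10}(p)$; (iii) $\{\ell_\infty(\widehat F,p)\}^\gamma=\widehat F_{11}(p)$. -/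

import Mathlib

open Filter Topology

namespace FibSeq

/-- Fibonacci numbers with the convention `f 0 = f 1 = 1`, as real numbers. -/
noncomputable def f (n : ℕ) : ℝ := (Nat.fib (n + 1) : ℝ)

/-- The multiplier space `S(X, Y)` of two sets of real sequences. -/
def multiplier (X Y : Set (ℕ → ℝ)) : Set (ℕ → ℝ) :=
  {z | ∀ x ∈ X, (fun k => x k * z k) ∈ Y}

/-- Absolutely convergent series. -/
def ell1 : Set (ℕ → ℝ) := {z | Summable fun k => |z k|}

/-- Convergent series: the partial sums have a limit. -/
def cs : Set (ℕ → ℝ) :=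
  {z | ∃ l : ℝ, Tendsto (fun n => ∑ k ∈ Finset.range (n + 1), z k) atTop (𝓝 l)}

/-- Bounded series: the partial sums are bounded. -/
def bs : Set (ℕ → ℝ) :=
  {z | BddAbove (Set.range fun n => |∑ k ∈ Finset.range (n + 1), z k|)}

def alphaDual (X : Set (ℕ → ℝ)) : Set (ℕ → ℝ) := multiplier X ell1

def betaDual (X : Set (ℕ → ℝ)) : Set (ℕ → ℝ) := multiplier X cs

def gammaDual (X : Set (ℕ → ℝ)) : Set (ℕ → ℝ) := multiplier X bs

/-- Maddox's space `ℓ_∞(p)`. -/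
def ellInfty (p : ℕ → ℝ) : Set (ℕ → ℝ) :=
  {x | BddAbove (Set.range fun k => |x k| ^ p k)}

/-- The transform by the Fibonacci band matrix, whose entries are `f n / f (n + 1)` on the
diagonal, `-f (n + 1) / f n` on the subdiagonal and `0` elsewhere. -/
noncomputable def fibTransform (x : ℕ → ℝ) : ℕ → ℝ
  | 0 => f 0 / f 1 * x 0
  | n + 1 => f (n + 1) / f (n + 2) * x (n + 1) - f (n + 2) / f (n + 1) * x n

/-- The space `ℓ_∞(F̂, p)`. -/
def ellInftyFib (p : ℕ → ℝ) : Set (ℕ → ℝ) := {x | fibTransform x ∈ ellInfty p}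

/-- The supremum over finite `K` of a series of nonnegative terms is taken in `[0, ∞]`. -/
def F8 (p : ℕ → ℝ) : Set (ℕ → ℝ) :=
  {a | ∀ B : ℕ, 1 < B →
    (⨆ K : Finset ℕ, ∑' n : ℕ,
      ENNReal.ofReal |∑ k ∈ K with k ≤ n,
        f (n + 1) ^ 2 / (f k * f (k + 1)) * a n * (B : ℝ) ^ (1 / p k)|) < ⊤}

def F9 (p : ℕ → ℝ) : Set (ℕ → ℝ) :=
  {a | ∀ B : ℕ, 1 < B →
    BddAbove (Set.range fun n : ℕ => ∑ k ∈ Finset.range (n + 1),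
      |∑ j ∈ Finset.Icc k n, f (j + 1) ^ 2 / (f k * f (k + 1)) * a j| * (B : ℝ) ^ (1 / p k))}

def F10 (p : ℕ → ℝ) : Set (ℕ → ℝ) :=
  {a | ∀ B : ℕ, 1 < B → ∃ α : ℕ → ℝ,
    Tendsto (fun n : ℕ => ∑ k ∈ Finset.range (n + 1),
      |(∑ j ∈ Finset.Icc k n, f (j + 1) ^ 2 / (f k * f (k + 1)) * a j) - α k| *
        (B : ℝ) ^ (1 / p k)) atTop (𝓝 0)}

def F11 (p : ℕ → ℝ) : Set (ℕ → ℝ) :=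
  {a | ∀ B : ℕ, 1 < B →
    BddAbove (Set.range fun n : ℕ => ∑ k ∈ Finset.range (n + 1),
      |∑ j ∈ Finset.Icc k n, f (j + 1) ^ 2 / (f k * f (k + 1)) * a j| * (B : ℝ) ^ (1 / p k))}

end FibSeq

namespace FibSeq

/-! The band matrix is invertible, and `ellInfty p` is the union over `B` of the boxes `|y k| ≤ B ^
(1 / p k)`. Each dual thus becomes a condition, box by box, on a matrix applied to `y`. For α, the
inverse has nonnegative entries, so the corner `y = u` with `u k = B ^ (1 / p k)` is the worst case.
For γ, uniform boundedness applies to the rows `d_{nk} u k`. For β, the entries factor: `d_{nk} = (T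
(n + 1) - T k) w k` with `w k = 1 / (f k * f (k + 1))`. With `S = lim T`, the deviation from the
column limit is `(T (n + 1) - S) w k`, whose sign does not depend on `k`. Testing `y = u` alone
therefore controls the whole sum in `F10`, and an Abel–Dini argument shows that its limit is zero.
-/

lemma f_pos (n : ℕ) : 0 < f n := by
  unfold f
  exact_mod_cast Nat.fib_pos.2 n.succ_pos

/-- The inverse of the Fibonacci band matrix. -/
noncomputable def fibInverse (y : ℕ → ℝ) (n : ℕ) : ℝ :=
  ∑ k ∈ Finset.range (n + 1), f (n + 1) ^ 2 / (f k * f (k + 1)) * y k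

lemma fibInverse_succ (y : ℕ → ℝ) (n : ℕ) :
    fibInverse y (n + 1) = f (n + 2) / f (n + 1) * y (n + 1)
      + f (n + 2) ^ 2 / f (n + 1) ^ 2 * fibInverse y n := by
  unfold fibInverse
  rw [Finset.sum_range_succ, Finset.mul_sum, add_comm]
  have h1 := (f_pos (n + 1)).ne'
  have h2 := (f_pos (n + 2)).ne'
  congr 1
  · field_simp
  · refine Finset.sum_congr rfl fun k _ => ?_
    have h3 := (f_pos k).ne'
    have h4 := (f_pos (k + 1)).ne'
    field_simp

lemma fibTransform_fibInverse (y : ℕ → ℝ) : fibTransform (fibInverse y) = y := by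
  funext n
  cases n with
  | zero => simp [fibTransform, fibInverse, f]
  | succ n =>
    have h1 := (f_pos (n + 1)).ne'
    have h2 := (f_pos (n + 2)).ne'
    simp only [fibTransform, fibInverse_succ]
    field_simp
    ring

lemma fibInverse_fibTransform (x : ℕ → ℝ) : fibInverse (fibTransform x) = x := by
  funext n
  induction n with
  | zero => simp [fibTransform, fibInverse, f]
  | succ n ih =>
    have h1 := (f_pos (n + 1)).ne'
    have h2 := (f_pos (n + 2)).ne'
    rw [fibInverse_succ, ih]
    simp only [fibTransform]
    field_simp
    ring

/-! ### Reduction of the duals to boxes -/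

lemma mem_ellInfty_iff {p : ℕ → ℝ} (hp : ∀ k, 0 < p k) {y : ℕ → ℝ} :
    y ∈ ellInfty p ↔ ∃ B : ℕ, 1 < B ∧ ∀ k, |y k| ≤ (B : ℝ) ^ (1 / p k) := by
  have key (B : ℕ) (k : ℕ) : |y k| ≤ (B : ℝ) ^ (1 / p k) ↔ |y k| ^ p k ≤ B := by
    rw [one_div, Real.le_rpow_inv_iff_of_pos (abs_nonneg _) B.cast_nonneg (hp k)]
  simp only [key]
  constructor
  · rintro ⟨M, hM⟩
    obtain ⟨B, hB⟩ := exists_nat_ge M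
    refine ⟨B + 2, by omega, fun k => (hM ⟨k, rfl⟩).trans (hB.trans ?_)⟩
    push_cast
    linarith
  · rintro ⟨B, -, hB⟩
    exact ⟨B, by rintro _ ⟨k, rfl⟩; exact hB k⟩

lemma mem_multiplier_ellInftyFib_iff {p : ℕ → ℝ} (hp : ∀ k, 0 < p k) {a : ℕ → ℝ}
    {Y : Set (ℕ → ℝ)} :
    a ∈ multiplier (ellInftyFib p) Y ↔ ∀ B : ℕ, 1 < B → ∀ y : ℕ → ℝ,
      (∀ k, |y k| ≤ (B : ℝ) ^ (1 / p k)) → (fun n => fibInverse y n * a n) ∈ Y := by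
  constructor
  · intro h B hB y hy
    refine h _ ?_
    change fibTransform (fibInverse y) ∈ ellInfty p
    rw [fibTransform_fibInverse]
    exact (mem_ellInfty_iff hp).2 ⟨B, hB, hy⟩
  · intro h x hx
    obtain ⟨B, hB, hy⟩ := (mem_ellInfty_iff hp).1 hx
    have := h B hB _ hy
    rwa [fibInverse_fibTransform] at this

/-- The entries `d_{nk}(a)` of the matrix sending `y` to the partial sums of `∑ aₙ xₙ`. -/
noncomputable def partialSumEntry (a : ℕ → ℝ) (n k : ℕ) : ℝ :=
  ∑ j ∈ Finset.Icc k n, f (j + 1) ^ 2 / (f k * f (k + 1)) * a j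

lemma sum_fibInverse_mul (a y : ℕ → ℝ) (n : ℕ) :
    ∑ j ∈ Finset.range (n + 1), fibInverse y j * a j =
      ∑ k ∈ Finset.range (n + 1), partialSumEntry a n k * y k := by
  simp only [fibInverse, partialSumEntry, Finset.sum_mul]
  rw [Finset.sum_comm' (t' := Finset.range (n + 1)) (s' := fun k => Finset.Icc k n)]
  · exact Finset.sum_congr rfl fun k _ => Finset.sum_congr rfl fun j _ => by ring
  · intro j k
    simp only [Finset.mem_range, Finset.mem_Icc]
    omega

/-! ### The γ-dual -/

lemma bddAbove_sum_abs_mul_of_forall_bddAbove (D : ℕ → ℕ → ℝ) (u : ℕ → ℝ) (hu : ∀ k, 0 ≤ u k)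
    (h : ∀ y : ℕ → ℝ, (∀ k, |y k| ≤ u k) →
      BddAbove (Set.range fun n : ℕ => |∑ k ∈ Finset.range (n + 1), D n k * y k|)) :
    BddAbove (Set.range fun n : ℕ => ∑ k ∈ Finset.range (n + 1), |D n k| * u k) := by
  let φ (n : ℕ) : BoundedContinuousFunction ℕ ℝ →L[ℝ] ℝ :=
    ∑ k ∈ Finset.range (n + 1), (D n k * u k) • BoundedContinuousFunction.evalCLM ℝ k
  have hφ (n : ℕ) (z : BoundedContinuousFunction ℕ ℝ) :
      φ n z = ∑ k ∈ Finset.range (n + 1), D n k * u k * z k := by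
    simp [φ]
  obtain ⟨C, hC⟩ := banach_steinhaus (g := φ) (fun z => by
    have hz : 0 < ‖z‖ + 1 := by positivity
    -- Rescaling puts `z` in the box; the `+ 1` avoids dividing by zero.
    obtain ⟨M, hM⟩ := h (fun k => u k * (z k / (‖z‖ + 1))) (fun k => by
      rw [abs_mul, abs_of_nonneg (hu k), abs_div, abs_of_pos hz]
      refine mul_le_of_le_one_right (hu k) ((div_le_one hz).2 ?_)
      have := z.norm_coe_le_norm k
      rw [Real.norm_eq_abs] at this
      linarith)
    refine ⟨M * (‖z‖ + 1), fun n => ?_⟩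
    rw [← div_le_iff₀ hz, hφ, Real.norm_eq_abs, ← abs_of_pos hz, ← abs_div,
      Finset.sum_div]
    refine le_of_eq_of_le ?_ (hM ⟨n, rfl⟩)
    exact congrArg abs (Finset.sum_congr rfl fun k _ => by ring))
  refine ⟨C, ?_⟩
  rintro _ ⟨n, rfl⟩
  -- The sign pattern of row `n` lies in the unit ball and recovers the full absolute row sum.
  let s : BoundedContinuousFunction ℕ ℝ :=
    BoundedContinuousFunction.ofNormedAddCommGroupDiscrete
      (fun k => (SignType.sign (D n k) : ℝ)) 1 (fun k => by
        rcases lt_trichotomy (D n k) 0 with h | h | h <;> simp [h])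
  have hs : ‖s‖ ≤ 1 := by
    refine (BoundedContinuousFunction.norm_le zero_le_one).2 fun k => ?_
    change ‖(SignType.sign (D n k) : ℝ)‖ ≤ 1
    rcases lt_trichotomy (D n k) 0 with h | h | h <;> simp [h]
  have hv : φ n s = ∑ k ∈ Finset.range (n + 1), |D n k| * u k := by
    rw [hφ]
    refine Finset.sum_congr rfl fun k _ => ?_
    change D n k * u k * (SignType.sign (D n k) : ℝ) = _
    rw [mul_right_comm, self_mul_sign]
  calc ∑ k ∈ Finset.range (n + 1), |D n k| * u k = φ n s := hv.symm
    _ ≤ ‖φ n s‖ := Real.le_norm_self _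
    _ ≤ ‖φ n‖ := (φ n).unit_le_opNorm s hs
    _ ≤ C := hC n

lemma gammaDual_ellInftyFib {p : ℕ → ℝ} (hp : ∀ k, 0 < p k) :
    gammaDual (ellInftyFib p) = F11 p := by
  ext a
  rw [gammaDual, mem_multiplier_ellInftyFib_iff hp]
  refine forall₂_congr fun B _ => ?_
  simp only [bs, Set.mem_ofPred_eq, sum_fibInverse_mul]
  refine ⟨bddAbove_sum_abs_mul_of_forall_bddAbove _ _ fun k => by positivity, ?_⟩
  rintro ⟨M, hM⟩ y hy
  refine ⟨M, ?_⟩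
  rintro _ ⟨n, rfl⟩
  refine le_trans (Finset.abs_sum_le_sum_abs _ _) (le_trans ?_ (hM ⟨n, rfl⟩))
  refine Finset.sum_le_sum fun k _ => ?_
  rw [abs_mul]
  exact mul_le_mul_of_nonneg_left (hy k) (abs_nonneg _)

/-! ### The α-dual -/

lemma fibInverse_mono_abs {y u : ℕ → ℝ} (h : ∀ k, |y k| ≤ u k) (n : ℕ) :
    |fibInverse y n| ≤ fibInverse u n := by
  refine (Finset.abs_sum_le_sum_abs _ _).trans (Finset.sum_le_sum fun k _ => ?_)
  have h1 := f_pos k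
  have h2 := f_pos (k + 1)
  rw [abs_mul, abs_of_nonneg (by positivity)]
  exact mul_le_mul_of_nonneg_left (h k) (by positivity)

lemma alphaDual_ellInftyFib {p : ℕ → ℝ} (hp : ∀ k, 0 < p k) :
    alphaDual (ellInftyFib p) = F8 p := by
  ext a
  rw [alphaDual, mem_multiplier_ellInftyFib_iff hp]
  refine forall₂_congr fun B _ => ?_
  set u : ℕ → ℝ := fun k => (B : ℝ) ^ (1 / p k) with hu
  have hu0 (k : ℕ) : 0 ≤ u k := by positivity
  have hterm (K : Finset ℕ) (n : ℕ) :
      ∑ k ∈ K with k ≤ n, f (n + 1) ^ 2 / (f k * f (k + 1)) * a n * u k =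
        (∑ k ∈ K with k ≤ n, f (n + 1) ^ 2 / (f k * f (k + 1)) * u k) * a n := by
    rw [Finset.sum_mul]
    exact Finset.sum_congr rfl fun k _ => by ring
  have hpos (n k : ℕ) : 0 ≤ f (n + 1) ^ 2 / (f k * f (k + 1)) * u k := by
    have h1 := f_pos k
    have h2 := f_pos (k + 1)
    have h3 := hu0 k
    positivity
  have hle (K : Finset ℕ) (n : ℕ) :
      |∑ k ∈ K with k ≤ n, f (n + 1) ^ 2 / (f k * f (k + 1)) * a n * u k| ≤
        |fibInverse u n * a n| := by
    rw [hterm, abs_mul, abs_mul]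
    refine mul_le_mul_of_nonneg_right ?_ (abs_nonneg _)
    rw [abs_of_nonneg (Finset.sum_nonneg fun k _ => hpos n k)]
    refine le_trans ?_ (le_abs_self _)
    refine Finset.sum_le_sum_of_subset_of_nonneg (fun k hk => ?_) fun k _ _ => hpos n k
    simp only [Finset.mem_filter] at hk
    simp only [Finset.mem_range]
    omega
  -- Initial segments `K` already attain the bound `hle` on the first `N` terms, so they suffice for
  -- the supremum.
  have heq (N n : ℕ) (hn : n < N) :
      |∑ k ∈ Finset.range N with k ≤ n, f (n + 1) ^ 2 / (f k * f (k + 1)) * a n * u k| =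
        |fibInverse u n * a n| := by
    rw [hterm, fibInverse]
    congr 3
    ext k
    simp only [Finset.mem_filter, Finset.mem_range]
    omega
  constructor
  · intro h
    have hs : Summable fun n => |fibInverse u n * a n| :=
      h u fun k => (abs_of_nonneg (hu0 k)).le
    refine lt_of_le_of_lt (iSup_le fun K => ?_) hs.tsum_ofReal_lt_top
    exact ENNReal.tsum_le_tsum fun n => ENNReal.ofReal_le_ofReal (hle K n)
  · intro h y hy
    have hs : Summable fun n => |fibInverse u n * a n| := by
      refine summable_of_sum_range_le (fun n => abs_nonneg _) (fun N => ?_)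
        (c := ENNReal.toReal (⨆ K : Finset ℕ, ∑' n : ℕ,
          ENNReal.ofReal |∑ k ∈ K with k ≤ n,
            f (n + 1) ^ 2 / (f k * f (k + 1)) * a n * u k|))
      rw [← ENNReal.ofReal_le_iff_le_toReal h.ne,
        ENNReal.ofReal_sum_of_nonneg fun _ _ => abs_nonneg _]
      refine le_trans ?_ (le_iSup _ (Finset.range N))
      refine le_trans (le_of_eq ?_) (ENNReal.sum_le_tsum (Finset.range N))
      exact Finset.sum_congr rfl fun n hn => by rw [heq N n (Finset.mem_range.1 hn)]
    refine Summable.of_nonneg_of_le (fun _ => abs_nonneg _) (fun n => ?_) hs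
    rw [abs_mul, abs_mul]
    exact mul_le_mul_of_nonneg_right ((fibInverse_mono_abs hy n).trans (le_abs_self _))
      (abs_nonneg _)

/-! ### The β-dual -/

/-- Abel–Dini: if `∑ vₙ₊₁ / Wₙ` converges, where `Wₙ = v₀ + ⋯ + vₙ`, then `W` is bounded. -/
lemma bddAbove_partialSum_of_summable_div {v : ℕ → ℝ} (hv : ∀ k, 0 < v k)
    (h : Summable fun n => v (n + 1) / ∑ k ∈ Finset.range (n + 1), v k) :
    ∃ M, ∀ n, ∑ k ∈ Finset.range (n + 1), v k ≤ M := by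
  have hW (n : ℕ) : 0 < ∑ k ∈ Finset.range (n + 1), v k :=
    Finset.sum_pos (fun k _ => hv k) ⟨0, by simp⟩
  -- Iterates `Wₙ₊₁ = Wₙ (1 + vₙ₊₁ / Wₙ) ≤ Wₙ exp (vₙ₊₁ / Wₙ)`.
  have key (n : ℕ) : ∑ k ∈ Finset.range (n + 1), v k ≤
      v 0 * Real.exp (∑ m ∈ Finset.range n, v (m + 1) / ∑ k ∈ Finset.range (m + 1), v k) := by
    induction n with
    | zero => simp
    | succ n ih =>
      rw [Finset.sum_range_succ _ n, Real.exp_add, ← mul_assoc]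
      refine le_trans ?_ (mul_le_mul ih (Real.add_one_le_exp _) ?_ ((hW n).le.trans ih))
      · rw [Finset.sum_range_succ _ (n + 1)]
        have := (hW n).ne'
        field_simp
        linarith
      · have := hW n
        have := hv (n + 1)
        positivity
  refine ⟨_, fun n => (key n).trans (mul_le_mul_of_nonneg_left
    (Real.exp_le_exp.2 (h.sum_le_tsum (Finset.range n) fun m _ => ?_)) (hv 0).le)⟩
  have := hW m
  have := hv (m + 1)
  positivity

/-- If `r n * Wₙ → L`, where `Wₙ = v₀ + ⋯ + vₙ`, while `r → 0` and `∑ |r n| vₙ₊₁` converges,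
then `L = 0`. -/
lemma eq_zero_of_tendsto_mul_partialSum {v r : ℕ → ℝ} {L : ℝ} (hv : ∀ k, 0 < v k)
    (hr : Tendsto r atTop (𝓝 0)) (hs : Summable fun n => |r n| * v (n + 1))
    (hL : Tendsto (fun n => r n * ∑ k ∈ Finset.range (n + 1), v k) atTop (𝓝 L)) : L = 0 := by
  have hW (n : ℕ) : 0 < ∑ k ∈ Finset.range (n + 1), v k :=
    Finset.sum_pos (fun k _ => hv k) ⟨0, by simp⟩
  by_contra hne
  have hLpos : 0 < |L| / 2 := by positivity
  have hev : ∀ᶠ n in atTop, |L| / 2 ≤ |r n * ∑ k ∈ Finset.range (n + 1), v k| :=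
    hL.abs.eventually_const_le (by linarith)
  -- If `L ≠ 0`, then eventually `1 / Wₙ ≤ (2 / |L|) |r n|`. Hence `W` is bounded, and `r → 0`
  -- forces `L = 0`.
  have hsum : Summable fun n => v (n + 1) / ∑ k ∈ Finset.range (n + 1), v k := by
    refine Summable.of_norm_bounded_eventually_nat (hs.mul_left (|L| / 2)⁻¹) ?_
    filter_upwards [hev] with n hn
    have h1 := hW n
    have h2 := hv (n + 1)
    rw [abs_mul, abs_of_pos h1] at hn
    rw [Real.norm_eq_abs, abs_of_pos (by positivity), div_le_iff₀ h1, inv_mul_eq_div,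
      div_mul_eq_mul_div, le_div_iff₀ hLpos]
    nlinarith
  obtain ⟨M, hM⟩ := bddAbove_partialSum_of_summable_div hv hsum
  refine hne (tendsto_nhds_unique hL ?_)
  refine hr.zero_mul_isBoundedUnder_le ?_
  refine isBoundedUnder_of ⟨M, fun n => ?_⟩
  simpa [abs_of_pos (hW n)] using hM n

lemma partialSumEntry_eq (a : ℕ → ℝ) {n k : ℕ} (hk : k ≤ n + 1) :
    partialSumEntry a n k = ((∑ j ∈ Finset.range (n + 1), f (j + 1) ^ 2 * a j)
      - ∑ j ∈ Finset.range k, f (j + 1) ^ 2 * a j) * (1 / (f k * f (k + 1))) := by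
  rw [← Finset.sum_Ico_eq_sub _ hk, partialSumEntry, Finset.sum_mul]
  refine Finset.sum_congr ?_ fun j _ => by ring
  ext j
  simp only [Finset.mem_Icc, Finset.mem_Ico]
  omega

/-- Fatou's lemma for series: truncate at a fixed `m`, then let `n` tend to infinity. -/
lemma summable_abs_mul_of_bddAbove {D : ℕ → ℕ → ℝ} {α u : ℕ → ℝ} {M : ℝ} (hu : ∀ k, 0 ≤ u k)
    (hM : ∀ n, ∑ k ∈ Finset.range (n + 1), |D n k| * u k ≤ M)
    (hα : ∀ k, Tendsto (fun n => D n k) atTop (𝓝 (α k))) :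
    Summable fun k => |α k| * u k := by
  refine summable_of_sum_range_le (c := M) (fun k => mul_nonneg (abs_nonneg _) (hu k))
    fun m => ?_
  refine le_of_tendsto (tendsto_finsetSum _ fun k _ => ((hα k).abs.mul_const (u k))) ?_
  filter_upwards [eventually_ge_atTop m] with n hn
  refine le_trans (Finset.sum_le_sum_of_subset_of_nonneg ?_ fun k _ _ =>
    mul_nonneg (abs_nonneg _) (hu k)) (hM n)
  exact Finset.range_subset_range.2 (by omega)

lemma mem_betaDual_of_mem {p : ℕ → ℝ} (hp : ∀ k, 0 < p k) {a : ℕ → ℝ} (h9 : a ∈ F9 p)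
    (h10 : a ∈ F10 p) : a ∈ betaDual (ellInftyFib p) := by
  rw [betaDual, mem_multiplier_ellInftyFib_iff hp]
  intro B hB y hy
  set u : ℕ → ℝ := fun k => (B : ℝ) ^ (1 / p k) with hu
  have hu0 (k : ℕ) : 0 < u k := Real.rpow_pos_of_pos (by exact_mod_cast (by omega : 0 < B)) _
  obtain ⟨M, hM⟩ := h9 B hB
  obtain ⟨α, hα⟩ := h10 B hB
  change Tendsto (fun n => ∑ k ∈ Finset.range (n + 1), |partialSumEntry a n k - α k| * u k)
    atTop (𝓝 0) at hα
  have hαlim (k : ℕ) : Tendsto (fun n => partialSumEntry a n k) atTop (𝓝 (α k)) := by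
    rw [tendsto_iff_norm_sub_tendsto_zero]
    have h0 := hα.div_const (u k)
    rw [zero_div] at h0
    refine squeeze_zero' (.of_forall fun _ => norm_nonneg _) ?_ h0
    filter_upwards [eventually_ge_atTop k] with n hn
    rw [le_div_iff₀ (hu0 k), Real.norm_eq_abs]
    exact Finset.single_le_sum (f := fun k => |partialSumEntry a n k - α k| * u k)
      (fun j _ => mul_nonneg (abs_nonneg _) (hu0 j).le) (Finset.mem_range.2 (by omega))
  have hsum : Summable fun k => |α k| * u k :=
    summable_abs_mul_of_bddAbove (fun k => (hu0 k).le) (fun n => hM ⟨n, rfl⟩) hαlim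
  have hαy : Summable fun k => α k * y k := by
    refine Summable.of_norm_bounded hsum fun k => ?_
    rw [Real.norm_eq_abs, abs_mul]
    exact mul_le_mul_of_nonneg_left (hy k) (abs_nonneg _)
  have hdiff : Tendsto (fun n => ∑ k ∈ Finset.range (n + 1),
      (partialSumEntry a n k - α k) * y k) atTop (𝓝 0) := by
    refine squeeze_zero_norm (fun n => ?_) hα
    rw [Real.norm_eq_abs]
    refine (Finset.abs_sum_le_sum_abs _ _).trans (Finset.sum_le_sum fun k _ => ?_)
    rw [abs_mul]
    exact mul_le_mul_of_nonneg_left (hy k) (abs_nonneg _)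
  refine ⟨0 + ∑' k, α k * y k,
    (hdiff.add ((tendsto_add_atTop_iff_nat 1).2 hαy.hasSum.tendsto_sum_nat)).congr fun n => ?_⟩
  rw [sum_fibInverse_mul, ← Finset.sum_add_distrib]
  exact Finset.sum_congr rfl fun k _ => by ring

lemma cs_subset_bs : cs ⊆ bs := fun _ ⟨_, hl⟩ => hl.abs.bddAbove_range

lemma betaDual_subset_F9 {p : ℕ → ℝ} (hp : ∀ k, 0 < p k) :
    betaDual (ellInftyFib p) ⊆ F9 p := fun a ha => by
  have : a ∈ gammaDual (ellInftyFib p) := fun x hx => cs_subset_bs (ha x hx)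
  rwa [gammaDual_ellInftyFib hp] at this

lemma betaDual_subset_F10 {p : ℕ → ℝ} (hp : ∀ k, 0 < p k) :
    betaDual (ellInftyFib p) ⊆ F10 p := fun a ha B hB => by
  obtain ⟨M, hM⟩ := betaDual_subset_F9 hp ha B hB
  rw [betaDual, mem_multiplier_ellInftyFib_iff hp] at ha
  set u : ℕ → ℝ := fun k => (B : ℝ) ^ (1 / p k) with hu
  have hB0 : (1 : ℝ) ≤ B := by exact_mod_cast hB.le
  have hu1 (k : ℕ) : 1 ≤ u k := Real.one_le_rpow hB0 (one_div_pos.2 (hp k)).le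
  have hu0 (k : ℕ) : 0 < u k := zero_lt_one.trans_le (hu1 k)
  have hw (k : ℕ) : 0 < 1 / (f k * f (k + 1)) :=
    one_div_pos.2 (mul_pos (f_pos _) (f_pos _))
  set T : ℕ → ℝ := fun n => ∑ j ∈ Finset.range n, f (j + 1) ^ 2 * a j with hT
  have hentry {n k : ℕ} (hk : k ≤ n + 1) :
      partialSumEntry a n k = (T (n + 1) - T k) * (1 / (f k * f (k + 1))) :=
    partialSumEntry_eq a hk
  -- The unit vector at `0` lies in the box since `u 0 ≥ 1`, and `d_{n0} = T (n + 1)` because `f 0 =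
  -- f 1 = 1`.
  obtain ⟨S, hS⟩ : ∃ S, Tendsto (fun n => T (n + 1)) atTop (𝓝 S) := by
    obtain ⟨S, hS⟩ := ha B hB (Pi.single 0 1) fun k => by
      rcases eq_or_ne k 0 with rfl | hk
      · rw [Pi.single_eq_same, abs_one]
        exact hu1 0
      · rw [Pi.single_eq_of_ne hk, abs_zero]
        exact (hu0 k).le
    refine ⟨S, hS.congr fun n => ?_⟩
    rw [sum_fibInverse_mul, Finset.sum_eq_single 0 (fun k _ hk => by simp [hk])
      (fun h => by simp at h), hentry (by omega)]
    simp [hT, f]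
  set α : ℕ → ℝ := fun k => (S - T k) * (1 / (f k * f (k + 1))) with hα
  have hαlim (k : ℕ) : Tendsto (fun n => partialSumEntry a n k) atTop (𝓝 (α k)) := by
    refine ((hS.sub_const (T k)).mul_const (1 / (f k * f (k + 1)))).congr' ?_
    filter_upwards [eventually_ge_atTop k] with n hn
    rw [hentry (by omega)]
  have hsum : Summable fun k => |α k| * u k :=
    summable_abs_mul_of_bddAbove (fun k => (hu0 k).le) (fun n => hM ⟨n, rfl⟩) hαlim
  have hsum' : Summable fun k => α k * u k := by
    refine Summable.of_norm_bounded hsum fun k => ?_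
    rw [Real.norm_eq_abs, abs_mul, abs_of_pos (hu0 k)]
  set v : ℕ → ℝ := fun k => 1 / (f k * f (k + 1)) * u k with hvdef
  have hv (k : ℕ) : 0 < v k := mul_pos (hw k) (hu0 k)
  have hdiff {n k : ℕ} (hk : k ≤ n + 1) :
      partialSumEntry a n k - α k = (T (n + 1) - S) * (1 / (f k * f (k + 1))) := by
    rw [hentry hk, hα]
    ring
  obtain ⟨l, hl⟩ := ha B hB u fun k => (abs_of_pos (hu0 k)).le
  have hL : Tendsto (fun n => (T (n + 1) - S) * ∑ k ∈ Finset.range (n + 1), v k) atTop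
      (𝓝 (l - ∑' k, α k * u k)) := by
    refine (hl.sub ((tendsto_add_atTop_iff_nat 1).2 hsum'.hasSum.tendsto_sum_nat)).congr
      fun n => ?_
    rw [sum_fibInverse_mul, ← Finset.sum_sub_distrib, Finset.mul_sum]
    refine Finset.sum_congr rfl fun k hk => ?_
    rw [← sub_mul, hdiff (Finset.mem_range.1 hk).le, mul_assoc]
  have hr : Tendsto (fun n => T (n + 1) - S) atTop (𝓝 0) := by
    simpa using hS.sub_const S
  -- These terms are exactly `|α (n + 1)| * u (n + 1)`; this shift is why the Abel–Dini lemma pairs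
  -- `vₙ₊₁` with `Wₙ`.
  have hrs : Summable fun n => |T (n + 1) - S| * v (n + 1) := by
    refine ((summable_nat_add_iff 1).2 hsum).congr fun n => ?_
    simp only [hα, hvdef]
    rw [abs_mul, abs_of_pos (hw (n + 1)), abs_sub_comm, mul_assoc]
  rw [eq_zero_of_tendsto_mul_partialSum hv hr hrs hL] at hL
  refine ⟨α, ?_⟩
  have := hL.abs
  rw [abs_zero] at this
  refine this.congr fun n => ?_
  rw [abs_mul, abs_of_nonneg (Finset.sum_nonneg fun k _ => (hv k).le), Finset.mul_sum]
  refine Finset.sum_congr rfl fun k hk => ?_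
  change _ = |partialSumEntry a n k - α k| * u k
  rw [hdiff (Finset.mem_range.1 hk).le, abs_mul, abs_of_pos (hw k), mul_assoc]

end FibSeq

theorem theorem2p10 (p : ℕ → ℝ) (hp : ∀ k, 0 < p k) (hbdd : BddAbove (Set.range p)) :
    FibSeq.alphaDual (FibSeq.ellInftyFib p) = FibSeq.F8 p ∧
    FibSeq.betaDual (FibSeq.ellInftyFib p) = FibSeq.F9 p ∩ FibSeq.F10 p ∧
    FibSeq.gammaDual (FibSeq.ellInftyFib p) = FibSeq.F11 p :=
  ⟨FibSeq.alphaDual_ellInftyFib hp,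
    Set.Subset.antisymm
      (Set.subset_inter (FibSeq.betaDual_subset_F9 hp) (FibSeq.betaDual_subset_F10 hp))
      fun _ h => FibSeq.mem_betaDual_of_mem hp h.1 h.2,
    FibSeq.gammaDual_ellInftyFib hp⟩
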